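/- Let $\mu\in\mathbb{R}^l$ be an unknown vector and consider nodes $1,\dots,n$. At each time $t=0,1,2,\dots$ let $G(t)=(\{1,\dots,n\},E(t))$ be an undirected graph without self-loops, let $N_i(t)$ be the set of neighbors of $i$ in $G(t)$ and $d_i(t)=|N_i(t)|$, and let $S(t)\subseteq\{1,\dots,n\}$ be the set of nodes that have a measurement at time $t$ (the $G(t)$ and $S(t)$ are arbitrary deterministic sequences). Assume: - ($B$-connectivity) for some integer $B\ge 1$, the graph $\bigl(\{1,\dots,n\},\bigcup_{t=kB+1}^{(k+1)B}E(t)\bigr)$ is connected for every integer $k\ge 0$; - (uniform measurement speed) the times $t$ with $S(t)\neq\emptyset$ form an infinite sequence $t_1<t_2<\cdots$ with $t_1=1$, and for some integer $T$, $|t_{k+1}-t_k|<T$ for all $k\ge1$. If $i$ and $j$ are neighbors at time $t$, node $i$ observes $o_{ij}(t)=v_j(t)-v_i(t)+w_{ij}(t)$, and if $i\in S(t)$, node $i$ observes $\mu_i(t)=\mu+w_i(t)$. Here all the random vectors $w_{ij}(t)$ (one for each time and each ordered pair of neighbors) and $w_i(t)$ (one for each time and each $i\in S(t)$) are mutually independent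 and have mean zero; every entry of every $w_{ij}(t)$ has finite variance $(\sigma')^2$ and every entry of every $w_i(t)$ has finite variance $\sigma^2$. From deterministic initial values $v_1(0),\dots,v_n(0)\in\mathbb{R}^l$ the estimates are updated by $$v_i(t+1)=v_i(t)+\frac{\Delta(t)}{4}\sum_{j\in N_i(t)}\frac{o_{ij}(t)}{\max(d_i(t),d_j(t))}\quad\text{if } i\notin S(t),$$ $$v_i(t+1)=v_i(t)+\frac{\Delta(t)}{4}\bigl(\mu_i(t)-v_i(t)\bigr)+\frac{\Delta(t)}{4}\sum_{j\in N_i(t)}\frac{o_{ij}(t)}{\max(d_i(t),d_j(t))}\quad\text{if } i\in S(t).$$ Suppose the stepsize $\Delta(t)$, $t\ge0$, is nonnegative, nonincreasing and satisfies $$\sum_{t=1}^\infty\Delta(t)=+\infty,\qquad \sum_{t=1}^\infty\Delta(t)^2<\infty,\qquad \sup_{t\ge1}\frac{\Delta(t)}{\Delta(t+c)}<\infty\ \text{ for every integer } c\ge 0.$$ Then for any initial values $v_1(0),\dots,v_n(0)$, with probability $1$, $$\lim_{t\to\infty}v_i(t)=\mu\quad\text{for all } i.$$ -/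

import Mathlib

open Filter Topology MeasureTheory ProbabilityTheory

namespace NetworkLearning

/-- A sequence of undirected loopless graphs on the nodes is `B`-connected: for every `k ≥ 0` the
union of the edge sets at the times `k * B + 1, …, (k + 1) * B` forms a connected graph. -/
def BConnected {n : ℕ} (G : ℕ → SimpleGraph (Fin n)) (B : ℕ) : Prop :=
  ∀ k : ℕ, (⨆ t ∈ Finset.Icc (k * B + 1) ((k + 1) * B), G t).Connected

/-- Uniform measurement speed: `S t` is the set of nodes which have a measurement at time `t`. The
times at which at least one node has a measurement form an infinite increasing sequence
(here `τ 0 < τ 1 < …`) whose first term is `1` and whose successive gaps are all less than `T`. -/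
def UniformMeasurementSpeed {n : ℕ} (S : ℕ → Finset (Fin n)) (T : ℕ) : Prop :=
  ∃ τ : ℕ → ℕ, StrictMono τ ∧ Set.range τ = {t | (S t).Nonempty} ∧ τ 0 = 1 ∧
    ∀ k, τ (k + 1) - τ k < T

/-- The noises which occur in the protocol: at time `t`, one for each ordered pair `(i, j)` of
neighbours, and one for each node which has a measurement. -/
abbrev NoiseIndex {n : ℕ} (G : ℕ → SimpleGraph (Fin n)) (S : ℕ → Finset (Fin n)) : Type :=
  Σ t : ℕ, {e : Fin n × Fin n // (G t).Adj e.1 e.2} ⊕ {i : Fin n // i ∈ S t}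

/-- The family of all noise vectors occurring in the protocol: `w t i j` is the noise in the offset
of `j` observed by `i` at time `t`, and `wm t i` the noise in the measurement made by `i`. -/
def noise {n l : ℕ} {Ω : Type*} (G : ℕ → SimpleGraph (Fin n)) (S : ℕ → Finset (Fin n))
    (w : ℕ → Fin n → Fin n → Ω → EuclideanSpace ℝ (Fin l))
    (wm : ℕ → Fin n → Ω → EuclideanSpace ℝ (Fin l)) :
    NoiseIndex G S → Ω → EuclideanSpace ℝ (Fin l)
  | ⟨t, Sum.inl e⟩ => w t e.1.1 e.1.2
  | ⟨t, Sum.inr i⟩ => wm t i.1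

/-- The probabilistic assumptions: all noise vectors are mutually independent square-integrable
random vectors of mean zero; every entry of an offset noise has variance `σ' ^ 2`, and every entry
of a measurement noise has variance `σ ^ 2`. (Entries of one vector may be dependent, and the
noises need not be identically distributed.) -/
structure IsNoise {n l : ℕ} {Ω : Type*} [MeasurableSpace Ω] (P : Measure Ω)
    (G : ℕ → SimpleGraph (Fin n)) (S : ℕ → Finset (Fin n))
    (w : ℕ → Fin n → Fin n → Ω → EuclideanSpace ℝ (Fin l))
    (wm : ℕ → Fin n → Ω → EuclideanSpace ℝ (Fin l)) (σ σ' : ℝ) : Prop where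
  measurable : ∀ a, Measurable (noise G S w wm a)
  memLp : ∀ a (m : Fin l), MemLp (fun ω => noise G S w wm a ω m) 2 P
  mean_zero : ∀ a (m : Fin l), ∫ ω, noise G S w wm a ω m ∂P = 0
  variance_offset : ∀ t i j, (G t).Adj i j → ∀ m : Fin l,
    variance (fun ω => w t i j ω m) P = σ' ^ 2
  variance_measurement : ∀ t, ∀ i ∈ S t, ∀ m : Fin l,
    variance (fun ω => wm t i ω m) P = σ ^ 2
  indep : iIndepFun (noise G S w wm) P

open Classical in
/-- The protocol: `estimate … t i ω` is the estimate `v_i(t)` of node `i` at time `t`.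
Node `i` observes the offsets `o_ij(t) = v_j(t) - v_i(t) + w_ij(t)` of its neighbours `j` and, if
`i ∈ S t`, the measurement `μ_i(t) = μ + w_i(t)`. -/
noncomputable def estimate {n l : ℕ} {Ω : Type*}
    (G : ℕ → SimpleGraph (Fin n)) (S : ℕ → Finset (Fin n)) (Δ : ℕ → ℝ)
    (μ : EuclideanSpace ℝ (Fin l))
    (w : ℕ → Fin n → Fin n → Ω → EuclideanSpace ℝ (Fin l))
    (wm : ℕ → Fin n → Ω → EuclideanSpace ℝ (Fin l))
    (v₀ : Fin n → EuclideanSpace ℝ (Fin l)) :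
    ℕ → Fin n → Ω → EuclideanSpace ℝ (Fin l)
  | 0 => fun i _ => v₀ i
  | t + 1 => fun i ω =>
      let v : Fin n → EuclideanSpace ℝ (Fin l) :=
        fun j => estimate G S Δ μ w wm v₀ t j ω
      let nudge : EuclideanSpace ℝ (Fin l) :=
        ∑ j ∈ (G t).neighborFinset i,
          (1 / (max ((G t).degree i) ((G t).degree j) : ℝ)) • (v j - v i + w t i j ω)
      if i ∈ S t then
        v i + (Δ t / 4) • ((μ + wm t i ω) - v i) + (Δ t / 4) • nudge
      else
        v i + (Δ t / 4) • nudge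

end NetworkLearning

/-! In each coordinate the error `x(t) = v(t) - μ` obeys `x(t+1) = x(t) - Δ(t) Q(t) x(t) + ξ(t)`,
where `Q(t)` is a weighted graph Laplacian plus the diagonal projection onto the measuring nodes,
divided by 4 (`drift`), and `ξ(t)` is noise with deterministic coefficients (`error_succ`).

The noise is disposed of first. Its coefficients are square summable, so `∑ ξ(t)` converges almost
surely (`ae_exists_tendsto_sum_noiseInput`), and the rest is pathwise. Adding the tail of this
series to `x` leaves the same recursion with a perturbation `Δ(t) e(t)`, `e(t) → 0`.

Each `Q(t)` is only positive semidefinite, but over a window containing a connected union of graphs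
and a measurement the sum of the quadratic forms is coercive (`exists_window_coercive`). To first
order in `Δ` the state is constant along a window, so the norm contracts by `1 - const * Δ` up to
`o(Δ)` (`tendsto_zero_of_window_coercive`). Divergence of `∑ Δ` finishes, and the ratio condition
keeps step sizes within a window comparable. -/

/-! ### Deterministic perturbed recursions -/

/-- A nonnegative sequence which contracts, up to an arbitrarily small relative error, with
non-summable rates tends to zero. -/
theorem tendsto_zero_of_contraction {u a : ℕ → ℝ} (hu : ∀ k, 0 ≤ u k)
    (ha : Tendsto a atTop (𝓝 0))
    (hsum : Tendsto (fun N => ∑ k ∈ Finset.range N, a k) atTop atTop)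
    (h : ∀ ε > 0, ∀ᶠ k in atTop, u (k + 1) ≤ (1 - a k) * u k + a k * ε) :
    Tendsto u atTop (𝓝 0) := by
  rw [Metric.tendsto_atTop]
  intro ε hε
  obtain ⟨k₀, hk₀⟩ := eventually_atTop.1
    ((h (ε / 2) (half_pos hε)).and (ha.eventually_le_const zero_lt_one))
  -- The map `u ↦ (1 - a) u + a ε/2` fixes `ε/2`, so only the excess over `ε/2` is multiplied by `1
  -- - a ≤ exp (-a)`.
  have key : ∀ j, u (k₀ + j) ≤
      ε / 2 + Real.exp (-∑ i ∈ Finset.range j, a (k₀ + i)) * u k₀ := by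
    intro j
    induction j with
    | zero => simpa using (half_pos hε).le
    | succ j ih =>
      obtain ⟨h1, h2⟩ := hk₀ (k₀ + j) (by omega)
      have h3 : 1 - a (k₀ + j) ≤ Real.exp (-a (k₀ + j)) := by
        have := Real.add_one_le_exp (-a (k₀ + j)); linarith
      rw [Finset.sum_range_succ, neg_add, Real.exp_add, ← add_assoc]
      set E := Real.exp (-∑ i ∈ Finset.range j, a (k₀ + i)) * u k₀ with hE
      have hE0 : 0 ≤ E := mul_nonneg (Real.exp_pos _).le (hu _)
      have h4 := mul_le_mul_of_nonneg_left ih (sub_nonneg.2 h2)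
      have h5 := mul_le_mul_of_nonneg_right h3 hE0
      calc u (k₀ + j + 1) ≤ _ := h1
        _ ≤ ε / 2 + Real.exp (-a (k₀ + j)) * E := by linarith
        _ = _ := by rw [hE]; ring
  have hshift : Tendsto (fun j => ∑ i ∈ Finset.range j, a (k₀ + i)) atTop atTop := by
    have h1 := (hsum.comp (tendsto_add_atTop_nat k₀))
    have h2 := tendsto_atTop_add_const_right atTop (-∑ k ∈ Finset.range k₀, a k) h1
    refine h2.congr fun j => ?_
    simp only [Function.comp]
    rw [add_comm j k₀, Finset.sum_range_add]
    ring
  have hlim : Tendsto (fun j => Real.exp (-∑ i ∈ Finset.range j, a (k₀ + i)) * u k₀)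
      atTop (𝓝 0) := by
    simpa using (Real.tendsto_exp_neg_atTop_nhds_zero.comp hshift).mul_const (u k₀)
  obtain ⟨j₀, hj₀⟩ := eventually_atTop.1 (hlim.eventually_lt_const (half_pos hε))
  refine ⟨k₀ + j₀, fun n hn => ?_⟩
  obtain ⟨j, rfl⟩ := Nat.exists_eq_add_of_le (le_trans (Nat.le_add_right k₀ j₀) hn)
  rw [Real.dist_0_eq_abs, abs_of_nonneg (hu _)]
  have h1 := key j
  have h2 := hj₀ j (by omega)
  linarith

section Recursion

variable {E : Type*} [NormedAddCommGroup E] [InnerProductSpace ℝ E]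
  {Q : ℕ → E →L[ℝ] E} {Δ : ℕ → ℝ} {y e : ℕ → E} {C ε : ℝ} {s : ℕ}

/-- For small steps `‖y‖` at most doubles and gains `ε`; hence `‖y‖ + ε` at most doubles. -/
theorem norm_recursion_add_le (hC : ∀ t x, ‖Q t x‖ ≤ C * ‖x‖)
    (hΔ_nonneg : ∀ t, 0 ≤ Δ t) (hΔ_anti : Antitone Δ)
    (hy : ∀ t, y (t + 1) = y t - Δ t • Q t (y t) + Δ t • e t)
    (he : ∀ t, s ≤ t → ‖e t‖ ≤ ε) (h1 : Δ s ≤ 1) (h2 : Δ s * C ≤ 1) (j : ℕ) :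
    ‖y (s + j)‖ + ε ≤ 2 ^ j * (‖y s‖ + ε) := by
  have hε : 0 ≤ ε := (norm_nonneg _).trans (he s le_rfl)
  induction j with
  | zero => simp
  | succ j ih =>
    have hD : Δ (s + j) ≤ Δ s := hΔ_anti (Nat.le_add_right _ _)
    have h0 := hΔ_nonneg (s + j)
    have n1 : ‖Δ (s + j) • Q (s + j) (y (s + j))‖ ≤ ‖y (s + j)‖ := by
      rw [norm_smul, Real.norm_of_nonneg h0]
      calc _ ≤ Δ s * (C * ‖y (s + j)‖) :=
            mul_le_mul hD (hC _ _) (norm_nonneg _) (h0.trans hD)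
        _ = Δ s * C * ‖y (s + j)‖ := by ring
        _ ≤ _ := mul_le_of_le_one_left (norm_nonneg _) h2
    have n2 : ‖Δ (s + j) • e (s + j)‖ ≤ ε := by
      rw [norm_smul, Real.norm_of_nonneg h0]
      exact (mul_le_of_le_one_left (norm_nonneg _) (hD.trans h1)).trans (he _ (by omega))
    have n3 : ‖y (s + (j + 1))‖ ≤ ‖y (s + j)‖ + ‖y (s + j)‖ + ε := by
      rw [← add_assoc, hy]
      exact (norm_add_le _ _).trans (add_le_add ((norm_sub_le _ _).trans
        (add_le_add le_rfl n1)) n2)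
    rw [pow_succ]
    linarith

theorem norm_recursion_sub_le (hC0 : 0 ≤ C) (hC : ∀ t x, ‖Q t x‖ ≤ C * ‖x‖)
    (hΔ_nonneg : ∀ t, 0 ≤ Δ t) (hΔ_anti : Antitone Δ)
    (hy : ∀ t, y (t + 1) = y t - Δ t • Q t (y t) + Δ t • e t)
    (he : ∀ t, s ≤ t → ‖e t‖ ≤ ε) (h1 : Δ s ≤ 1) (h2 : Δ s * C ≤ 1) (j : ℕ) :
    ‖y (s + j) - y s‖ ≤ Δ s * (C + 1) * 2 ^ j * (‖y s‖ + ε) := by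
  have hε : 0 ≤ ε := (norm_nonneg _).trans (he s le_rfl)
  induction j with
  | zero => simp; have := hΔ_nonneg s; positivity
  | succ j ih =>
    have hD : Δ (s + j) ≤ Δ s := hΔ_anti (Nat.le_add_right _ _)
    have h0 := hΔ_nonneg (s + j)
    have hg := norm_recursion_add_le hC hΔ_nonneg hΔ_anti hy he h1 h2 j
    have n1 : ‖Δ (s + j) • (e (s + j) - Q (s + j) (y (s + j)))‖ ≤
        Δ s * ((C + 1) * (2 ^ j * (‖y s‖ + ε))) := by
      rw [norm_smul, Real.norm_of_nonneg h0]
      refine mul_le_mul hD ?_ (norm_nonneg _) (h0.trans hD)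
      calc _ ≤ ‖e (s + j)‖ + ‖Q (s + j) (y (s + j))‖ := norm_sub_le _ _
        _ ≤ ε + C * ‖y (s + j)‖ := add_le_add (he _ (by omega)) (hC _ _)
        _ ≤ (C + 1) * (‖y (s + j)‖ + ε) := by nlinarith [norm_nonneg (y (s + j))]
        _ ≤ _ := mul_le_mul_of_nonneg_left hg (by linarith)
    have n2 : y (s + (j + 1)) - y s =
        (y (s + j) - y s) + Δ (s + j) • (e (s + j) - Q (s + j) (y (s + j))) := by
      rw [← add_assoc, hy, smul_sub]; abel
    rw [n2]
    calc _ ≤ _ := norm_add_le _ _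
      _ ≤ _ := add_le_add ih n1
      _ = _ := by rw [pow_succ]; ring

/-- Freezing the state at `y s` costs, per step, `Δ s * C` times the drift of the state since time
`s`, which is itself `O(Δ s)`. The error is thus second order in `Δ s`, apart from the terms in `ε`.
-/
theorem norm_recursion_sub_linear_le (hC0 : 0 ≤ C) (hC : ∀ t x, ‖Q t x‖ ≤ C * ‖x‖)
    (hΔ_nonneg : ∀ t, 0 ≤ Δ t) (hΔ_anti : Antitone Δ)
    (hy : ∀ t, y (t + 1) = y t - Δ t • Q t (y t) + Δ t • e t)
    (he : ∀ t, s ≤ t → ‖e t‖ ≤ ε) (h1 : Δ s ≤ 1) (h2 : Δ s * C ≤ 1) {K j : ℕ} (hj : j ≤ K) :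
    ‖y (s + j) - (y s - ∑ i ∈ Finset.range j, Δ (s + i) • Q (s + i) (y s))‖ ≤
      j * (Δ s * (C * (Δ s * (C + 1) * 2 ^ K * (‖y s‖ + ε)) + ε)) := by
  have hε : 0 ≤ ε := (norm_nonneg _).trans (he s le_rfl)
  induction j with
  | zero => simp
  | succ j ih =>
    have hD : Δ (s + j) ≤ Δ s := hΔ_anti (Nat.le_add_right _ _)
    have h0 := hΔ_nonneg (s + j)
    have hg := norm_recursion_sub_le hC0 hC hΔ_nonneg hΔ_anti hy he h1 h2 j
    have hpow : (2 : ℝ) ^ j ≤ 2 ^ K := pow_le_pow_right₀ one_le_two (by omega)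
    have n1 : ‖Δ (s + j) • (e (s + j) - Q (s + j) (y (s + j) - y s))‖ ≤
        Δ s * (C * (Δ s * (C + 1) * 2 ^ K * (‖y s‖ + ε)) + ε) := by
      rw [norm_smul, Real.norm_of_nonneg h0]
      refine mul_le_mul hD ?_ (norm_nonneg _) (h0.trans hD)
      calc _ ≤ ‖e (s + j)‖ + ‖Q (s + j) (y (s + j) - y s)‖ := norm_sub_le _ _
        _ ≤ ε + C * ‖y (s + j) - y s‖ := add_le_add (he _ (by omega)) (hC _ _)
        _ ≤ ε + C * (Δ s * (C + 1) * 2 ^ K * (‖y s‖ + ε)) := by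
          have := hΔ_nonneg s
          gcongr
          exact hg.trans (by gcongr)
        _ = _ := add_comm _ _
    have n2 : y (s + (j + 1)) -
          (y s - ∑ i ∈ Finset.range (j + 1), Δ (s + i) • Q (s + i) (y s)) =
        (y (s + j) - (y s - ∑ i ∈ Finset.range j, Δ (s + i) • Q (s + i) (y s))) +
          Δ (s + j) • (e (s + j) - Q (s + j) (y (s + j) - y s)) := by
      rw [← add_assoc, hy, Finset.sum_range_succ, map_sub, smul_sub, smul_sub]; abel
    rw [n2]
    calc _ ≤ _ := norm_add_le _ _
      _ ≤ _ := add_le_add (ih (by omega)) n1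
      _ = _ := by push_cast; ring

/-- A small step along an operator which is bounded and coercive contracts the norm. -/
theorem norm_sub_le_of_coercive {x z : E} {κ M d : ℝ} (hd : 0 ≤ d)
    (hz : ‖z‖ ≤ d * M * ‖x‖) (hinner : κ * d * ‖x‖ ^ 2 ≤ inner ℝ z x)
    (h1 : d * M ^ 2 ≤ κ) (h2 : κ * d ≤ 1) :
    ‖x - z‖ ≤ (1 - κ * d / 2) * ‖x‖ := by
  -- Expanding the square gives a factor `1 - 2κd + d²M² ≤ 1 - κd ≤ (1 - κd/2)²`.
  refine le_of_sq_le_sq ?_ (mul_nonneg (by nlinarith) (norm_nonneg _))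
  have hz2 : ‖z‖ ^ 2 ≤ (d * M * ‖x‖) ^ 2 := pow_le_pow_left₀ (norm_nonneg _) hz 2
  have h3 : (d * M * ‖x‖) ^ 2 ≤ κ * d * ‖x‖ ^ 2 := by
    have : (d * M * ‖x‖) ^ 2 = (d * M ^ 2) * (d * ‖x‖ ^ 2) := by ring
    rw [this]
    calc _ ≤ κ * (d * ‖x‖ ^ 2) := by gcongr
      _ = _ := by ring
  rw [norm_sub_sq_real, real_inner_comm]
  nlinarith [sq_nonneg (κ * d * ‖x‖)]

theorem tendsto_zero_of_window_coercive {c : ℝ} {K : ℕ} (hK : 0 < K) (hC0 : 0 ≤ C)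
    (hC : ∀ t x, ‖Q t x‖ ≤ C * ‖x‖) (hQ : ∀ t x, 0 ≤ inner ℝ (Q t x) x) (hc0 : 0 < c)
    (hc : ∀ k x, c * ‖x‖ ^ 2 ≤
      ∑ j ∈ Finset.range K, inner ℝ (Q (k * K + 1 + j) x) x)
    (hΔ_nonneg : ∀ t, 0 ≤ Δ t) (hΔ_anti : Antitone Δ)
    (hΔ_lim : Tendsto Δ atTop (𝓝 0))
    (hΔ_sum : Tendsto (fun N : ℕ => ∑ t ∈ Finset.Icc 1 N, Δ t) atTop atTop)
    {ρ : ℝ} (hρ0 : 0 < ρ) (hρ : ∀ t, 1 ≤ t → Δ t ≤ ρ * Δ (t + K))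
    (hy : ∀ t, y (t + 1) = y t - Δ t • Q t (y t) + Δ t • e t)
    (he : Tendsto e atTop (𝓝 0)) : Tendsto y atTop (𝓝 0) := by
  have hs : Tendsto (fun k => k * K + 1) atTop atTop :=
    tendsto_atTop_mono (fun k => (Nat.le_mul_of_pos_right k hK).trans (Nat.le_succ _)) tendsto_id
  have he' : ∀ ε > 0, ∀ᶠ k in atTop, ∀ t, k * K + 1 ≤ t → ‖e t‖ ≤ ε := by
    intro ε hε
    have := (tendsto_zero_iff_norm_tendsto_zero.1 he).eventually_le_const hε
    exact hs.eventually (eventually_forall_ge_atTop.2 this)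
  have hΔs : Tendsto (fun k => Δ (k * K + 1)) atTop (𝓝 0) := hΔ_lim.comp hs
  have hsmall : ∀ M η : ℝ, 0 < η → ∀ᶠ k in atTop, Δ (k * K + 1) * M ≤ η := by
    intro M η hη
    exact Tendsto.eventually_le_const hη (by simpa using hΔs.mul_const M)
  -- Every step in a window is at least `Δ s / ρ`, which degrades the coercivity constant to `c /
  -- ρ`.
  obtain ⟨κ, hκ⟩ : ∃ κ, κ = c / ρ := ⟨_, rfl⟩
  have hκ0 : 0 < κ := hκ ▸ div_pos hc0 hρ0
  have hu : Tendsto (fun k => ‖y (k * K + 1)‖) atTop (𝓝 0) := by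
    -- Coercivity yields the rate `κ/2`; half of it is spent on the second-order error, leaving
    -- `κ/4`.
    refine tendsto_zero_of_contraction (a := fun k => κ / 4 * Δ (k * K + 1))
      (fun _ => norm_nonneg _) (by simpa using hΔs.const_mul (κ / 4)) ?_ ?_
    · have hle : ∀ N, ∑ t ∈ Finset.Icc 1 (N * K), Δ t ≤
          K * ∑ k ∈ Finset.range N, Δ (k * K + 1) := by
        intro N
        induction N with
        | zero => simp
        | succ N ih =>
          have : ∑ t ∈ Finset.Icc 1 ((N + 1) * K), Δ t =
              ∑ t ∈ Finset.Icc 1 (N * K), Δ t + ∑ j ∈ Finset.range K, Δ (N * K + 1 + j) := by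
            simp only [← Finset.Ico_succ_right_eq_Icc, Order.succ_eq_add_one]
            rw [Finset.sum_Ico_eq_sum_range, Finset.sum_Ico_eq_sum_range]
            have h : (N + 1) * K + 1 - 1 = (N * K + 1 - 1) + K := by
              simp [Nat.succ_mul]
            rw [h, Finset.sum_range_add]
            congr 1
            refine Finset.sum_congr rfl fun j _ => ?_
            congr 1
            simp; ring
          rw [this, Finset.sum_range_succ, mul_add]
          refine add_le_add ih ?_
          calc _ ≤ ∑ j ∈ Finset.range K, Δ (N * K + 1) :=
                Finset.sum_le_sum fun j _ => hΔ_anti (Nat.le_add_right _ _)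
            _ = _ := by simp
      have h1 : Tendsto (fun N : ℕ => ∑ t ∈ Finset.Icc 1 (N * K), Δ t) atTop atTop :=
        hΔ_sum.comp (tendsto_atTop_mono (fun k => Nat.le_mul_of_pos_right k hK) tendsto_id)
      have h2 := tendsto_atTop_mono hle h1
      have hK' : (0 : ℝ) < K := by exact_mod_cast hK
      have h3 := Tendsto.const_mul_atTop (r := κ / 4 / K) (by positivity) h2
      refine h3.congr fun N => ?_
      rw [← Finset.mul_sum]; field_simp
    · intro ε hε
      -- Chosen so that the total perturbation `(κ/4 + K) δ` equals `ε κ/4`.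
      obtain ⟨δ, hδ⟩ : ∃ δ, δ = ε * (κ / 4) / (κ / 4 + K) := ⟨_, rfl⟩
      have hδ0 : 0 < δ := by rw [hδ]; positivity
      filter_upwards [he' δ hδ0, hsmall 1 1 one_pos, hsmall C 1 one_pos,
        hsmall ((K * C) ^ 2) κ hκ0, hsmall κ 1 one_pos,
        hsmall (K * C * (C + 1) * 2 ^ K) (κ / 4) (by positivity)] with k e1 e2 e3 e4 e5 e6
      rw [mul_one] at e2
      obtain ⟨s, hsd⟩ : ∃ s, s = k * K + 1 := ⟨_, rfl⟩
      have hsucc : (k + 1) * K + 1 = s + K := by rw [hsd]; ring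
      rw [hsucc]
      have hc' := hc k (y s)
      rw [← hsd] at e1 e2 e3 e4 e5 e6 hc' ⊢
      have hlin := norm_recursion_sub_linear_le hC0 hC hΔ_nonneg hΔ_anti hy e1 e2 e3 (le_refl K)
      set W := ∑ i ∈ Finset.range K, Δ (s + i) • Q (s + i) (y s) with hW
      have hd := hΔ_nonneg s
      have hWn : ‖W‖ ≤ Δ s * (K * C) * ‖y s‖ := by
        calc ‖W‖ ≤ ∑ i ∈ Finset.range K, ‖Δ (s + i) • Q (s + i) (y s)‖ := norm_sum_le _ _
          _ ≤ ∑ i ∈ Finset.range K, Δ s * (C * ‖y s‖) := by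
            refine Finset.sum_le_sum fun i _ => ?_
            rw [norm_smul, Real.norm_of_nonneg (hΔ_nonneg _)]
            exact mul_le_mul (hΔ_anti (Nat.le_add_right _ _)) (hC _ _) (norm_nonneg _) hd
          _ = _ := by simp; ring
      have hWi : κ * Δ s * ‖y s‖ ^ 2 ≤ inner ℝ W (y s) := by
        have hr := hρ s (by omega)
        rw [hW, sum_inner]
        calc κ * Δ s * ‖y s‖ ^ 2 ≤ κ * (ρ * Δ (s + K)) * ‖y s‖ ^ 2 := by gcongr
          _ = Δ (s + K) * (c * ‖y s‖ ^ 2) := by rw [hκ]; field_simp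
          _ ≤ Δ (s + K) * ∑ j ∈ Finset.range K, inner ℝ (Q (s + j) (y s)) (y s) :=
            mul_le_mul_of_nonneg_left hc' (hΔ_nonneg _)
          _ ≤ _ := by
            rw [Finset.mul_sum]
            refine Finset.sum_le_sum fun j hj => ?_
            rw [real_inner_smul_left]
            have := Finset.mem_range.1 hj
            exact mul_le_mul_of_nonneg_right (hΔ_anti (by omega)) (hQ _ _)
      have hcon := norm_sub_le_of_coercive hd hWn hWi e4 (by linarith)
      have htri : ‖y (s + K)‖ ≤ ‖y (s + K) - (y s - W)‖ + ‖y s - W‖ := by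
        simpa using norm_add_le (y (s + K) - (y s - W)) (y s - W)
      have hrem : K * (Δ s * (C * (Δ s * (C + 1) * 2 ^ K * (‖y s‖ + δ)) + δ)) ≤
          κ / 4 * Δ s * (‖y s‖ + δ) + K * Δ s * δ := by
        have : Δ s * (K * C * (C + 1) * 2 ^ K) * (Δ s * (‖y s‖ + δ)) ≤
            κ / 4 * (Δ s * (‖y s‖ + δ)) := by gcongr
        linarith
      have hfin : (κ / 4 + K) * δ = ε * (κ / 4) := by rw [hδ]; field_simp
      have hfin' : Δ s * ((κ / 4 + K) * δ) = Δ s * (ε * (κ / 4)) := by rw [hfin]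
      linarith
  rw [Metric.tendsto_atTop]
  intro ε hε
  have h2K : (0 : ℝ) < 2 ^ K := by positivity
  -- Convergence at window starts extends to all times, since growth inside a window is at most `2 ^
  -- K`.
  obtain ⟨k₀, hk₀⟩ := eventually_atTop.1 ((he' (ε / 2 ^ K / 2) (by positivity)).and
    ((hsmall 1 1 one_pos).and ((hsmall C 1 one_pos).and
      (hu.eventually_lt_const (u := ε / 2 ^ K / 2) (by positivity)))))
  refine ⟨k₀ * K + 1, fun t ht => ?_⟩
  obtain ⟨k, j, hk, hj, rfl⟩ : ∃ k j, k₀ ≤ k ∧ j ≤ K ∧ t = k * K + 1 + j := by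
    refine ⟨(t - 1) / K, (t - 1) % K, (Nat.le_div_iff_mul_le hK).2 (by omega),
      (Nat.mod_lt _ hK).le, ?_⟩
    have := Nat.div_add_mod' (t - 1) K
    omega
  obtain ⟨e1, e2, e3, e4⟩ := hk₀ k hk
  rw [mul_one] at e2
  have hb := norm_recursion_add_le hC hΔ_nonneg hΔ_anti hy e1 e2 e3 j
  have hpow : (2 : ℝ) ^ j ≤ 2 ^ K := pow_le_pow_right₀ one_le_two hj
  rw [dist_zero_right]
  have : 0 < ε / 2 ^ K / 2 := by positivity
  calc ‖y (k * K + 1 + j)‖ < ‖y (k * K + 1 + j)‖ + ε / 2 ^ K / 2 := by linarith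
    _ ≤ _ := hb
    _ ≤ 2 ^ K * (‖y (k * K + 1)‖ + ε / 2 ^ K / 2) := by gcongr
    _ ≤ 2 ^ K * (ε / 2 ^ K / 2 + ε / 2 ^ K / 2) := by gcongr
    _ = ε := by field_simp; ring

/-- Perturbing the recursion by the terms of a convergent series does not affect the limit. -/
theorem tendsto_zero_of_window_coercive_of_convergent_noise {c : ℝ} {K : ℕ} (hK : 0 < K)
    (hC0 : 0 ≤ C) (hC : ∀ t x, ‖Q t x‖ ≤ C * ‖x‖) (hQ : ∀ t x, 0 ≤ inner ℝ (Q t x) x)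
    (hc0 : 0 < c)
    (hc : ∀ k x, c * ‖x‖ ^ 2 ≤
      ∑ j ∈ Finset.range K, inner ℝ (Q (k * K + 1 + j) x) x)
    (hΔ_nonneg : ∀ t, 0 ≤ Δ t) (hΔ_anti : Antitone Δ)
    (hΔ_lim : Tendsto Δ atTop (𝓝 0))
    (hΔ_sum : Tendsto (fun N : ℕ => ∑ t ∈ Finset.Icc 1 N, Δ t) atTop atTop)
    {ρ : ℝ} (hρ0 : 0 < ρ) (hρ : ∀ t, 1 ≤ t → Δ t ≤ ρ * Δ (t + K))
    {x ξ : ℕ → E} {L : E} (hx : ∀ t, x (t + 1) = x t - Δ t • Q t (x t) + ξ t)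
    (hξ : Tendsto (fun N => ∑ t ∈ Finset.range N, ξ t) atTop (𝓝 L)) :
    Tendsto x atTop (𝓝 0) := by
  have hR : Tendsto (fun t => L - ∑ r ∈ Finset.range t, ξ r) atTop (𝓝 0) := by
    simpa using hξ.const_sub L
  have he : Tendsto (fun t => Q t (L - ∑ r ∈ Finset.range t, ξ r)) atTop (𝓝 0) :=
    squeeze_zero_norm (fun t => hC t _)
      (by simpa using (tendsto_zero_iff_norm_tendsto_zero.1 hR).const_mul C)
  -- Adding the tail of the noise series cancels `ξ t` and leaves the perturbation `Q t` applied to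
  -- the tail.
  have hy := tendsto_zero_of_window_coercive
    (y := fun t => x t + (L - ∑ r ∈ Finset.range t, ξ r)) hK hC0 hC hQ hc0 hc hΔ_nonneg hΔ_anti
    hΔ_lim hΔ_sum hρ0 hρ (fun t => by
      rw [hx, Finset.sum_range_succ, map_add, smul_add]; abel) he
  simpa using hy.sub hR

end Recursion

/-! ### Almost sure convergence of noise series -/

/-- Extending an independent family by zeros keeps it independent. -/
theorem iIndepFun_of_subtype {ι Ω : Type*} [MeasurableSpace Ω] {P : Measure Ω}
    [IsProbabilityMeasure P] {p : ι → Prop} {Y : ι → Ω → ℝ}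
    (h : iIndepFun (fun i : {i // p i} => Y i) P) (h0 : ∀ i, ¬ p i → Y i = 0) :
    iIndepFun Y P := by
  classical
  rw [iIndepFun_iff_measure_inter_preimage_eq_mul] at h ⊢
  intro s A hA
  by_cases hbad : ∃ i ∈ s, ¬ p i ∧ (0 : ℝ) ∉ A i
  · obtain ⟨i, hi, hpi, hAi⟩ := hbad
    have hemp : Y i ⁻¹' A i = ∅ := by
      ext ω; simp [h0 i hpi, hAi]
    rw [Finset.prod_eq_zero hi (by simp [hemp])]
    exact measure_mono_null (Set.biInter_subset_of_mem hi) (by simp [hemp])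
  · push Not at hbad
    have huniv : ∀ i ∈ s, ¬ p i → Y i ⁻¹' A i = Set.univ := by
      intro i hi hpi
      ext ω; simp [h0 i hpi, hbad i hi hpi]
    have h1 := h (s.subtype p) (sets := fun i => A i)
      (fun i hi => hA i (Finset.mem_subtype.1 hi))
    have h2 : ⋂ i ∈ s.subtype p, Y i ⁻¹' A i = ⋂ i ∈ s, Y i ⁻¹' A i := by
      ext ω
      simp only [Set.mem_iInter, Finset.mem_subtype]
      refine ⟨fun hω i hi => ?_, fun hω i hi => hω i hi⟩
      by_cases hpi : p i
      · exact hω ⟨i, hpi⟩ hi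
      · rw [huniv i hi hpi]; trivial
    rw [← h2, h1, Finset.prod_subtype_eq_prod_filter (f := fun i => P (Y i ⁻¹' A i)),
      Finset.prod_filter]
    refine Finset.prod_congr rfl fun i hi => ?_
    split_ifs with hpi
    · rfl
    · rw [huniv i hi hpi, measure_univ]

/-- A series of independent centred random variables with summable variances converges almost
surely. -/
theorem ae_exists_tendsto_sum_of_summable_variance {Ω : Type*} [MeasurableSpace Ω]
    {P : Measure Ω} [IsProbabilityMeasure P] {X : ℕ → Ω → ℝ} (hmeas : ∀ t, Measurable (X t))
    (hind : iIndepFun X P) (hL2 : ∀ t, MemLp (X t) 2 P) (hmean : ∀ t, ∫ ω, X t ω ∂P = 0)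
    (hvar : Summable fun t => variance (X t) P) :
    ∀ᵐ ω ∂P, ∃ a, Tendsto (fun N => ∑ t ∈ Finset.range N, X t ω) atTop (𝓝 a) := by
  have hsm : ∀ t, StronglyMeasurable (X t) := fun t => (hmeas t).stronglyMeasurable
  -- The sum includes the index `N`, matching the natural filtration, which at time `N` already
  -- knows `X N`.
  set M : ℕ → Ω → ℝ := fun N => ∑ t ∈ Finset.range (N + 1), X t with hM
  have hML2 : ∀ N, MemLp (M N) 2 P := fun N => memLp_finsetSum' _ fun t _ => hL2 t
  have hmart : Martingale M (Filtration.natural X hsm) P := by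
    refine martingale_of_condExp_sub_eq_zero_nat (fun N => ?_)
      (fun N => (hML2 N).integrable one_le_two) fun N => ?_
    · refine Finset.stronglyMeasurable_sum _ fun t ht => ?_
      exact (Filtration.stronglyAdapted_natural hsm t).mono
        ((Filtration.natural X hsm).mono (Nat.lt_succ_iff.1 (Finset.mem_range.1 ht)))
    · have : M (N + 1) - M N = X (N + 1) := by
        simp only [hM]; rw [Finset.sum_range_succ _ (N + 1)]; simp
      rw [this]
      refine (hind.condExp_natural_ae_eq_of_lt hsm (Nat.lt_succ_self N)).trans ?_
      rw [hmean]; rfl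
  -- The `L¹` norm is at most the `L²` norm, whose square is the variance, additive by independence.
  have hbdd : ∀ N, eLpNorm (M N) 1 P ≤ (Real.toNNReal (Real.sqrt (∑' t, variance (X t) P)) :) := by
    intro N
    have hmeanM : ∫ ω, M N ω ∂P = 0 := by
      simp only [hM, Finset.sum_apply]
      rw [integral_finsetSum _ fun t _ => (hL2 t).integrable one_le_two]
      simp [hmean]
    have hvarM : variance (M N) P ≤ ∑' t, variance (X t) P := by
      rw [hM, IndepFun.variance_sum (fun t _ => hL2 t) fun i _ j _ hij => hind.indepFun hij]
      exact hvar.sum_le_tsum _ fun t _ => variance_nonneg _ _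
    refine (eLpNorm_le_eLpNorm_of_exponent_le one_le_two (hML2 N).1).trans ?_
    rw [variance_of_integral_eq_zero (hML2 N).1.aemeasurable hmeanM] at hvarM
    rw [MemLp.eLpNorm_eq_integral_rpow_norm two_ne_zero ENNReal.ofNat_ne_top (hML2 N)]
    refine ENNReal.ofReal_le_ofReal ?_
    simp only [ENNReal.toReal_ofNat, Real.rpow_ofNat, Real.norm_eq_abs, sq_abs]
    rw [← one_div, ← Real.sqrt_eq_rpow]
    exact Real.sqrt_le_sqrt hvarM
  filter_upwards [hmart.submartingale.exists_ae_tendsto_of_bdd hbdd] with ω hω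
  obtain ⟨a, ha⟩ := hω
  refine ⟨a, (tendsto_add_atTop_iff_nat 1).1 ?_⟩
  simpa [hM] using ha

/-- A weighted series of independent noises, of which each occurs at most once, converges almost
surely when the weights are square summable. -/
theorem ae_exists_tendsto_weighted_sum {Ω α : Type*} {l : ℕ} [MeasurableSpace Ω]
    {P : Measure Ω} [IsProbabilityMeasure P] {Z : α → Ω → EuclideanSpace ℝ (Fin l)}
    (hmeas : ∀ a, Measurable (Z a)) (hind : iIndepFun Z P) (m : Fin l)
    (hL2 : ∀ a, MemLp (fun ω => Z a ω m) 2 P) (hmean : ∀ a, ∫ ω, Z a ω m ∂P = 0)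
    {p : ℕ → Prop} {g : {t // p t} → α} (hg : g.Injective) {V : ℝ}
    (hV : ∀ t, variance (fun ω => Z (g t) ω m) P ≤ V)
    {b Δ : ℕ → ℝ} (hb : ∀ t, |b t| ≤ Δ t) (hΔ : Summable fun t => Δ t ^ 2)
    {X : ℕ → Ω → ℝ} (hX : ∀ t (h : p t) ω, X t ω = b t * Z (g ⟨t, h⟩) ω m)
    (hX0 : ∀ t, ¬ p t → X t = 0) :
    ∀ᵐ ω ∂P, ∃ a, Tendsto (fun N => ∑ t ∈ Finset.range N, X t ω) atTop (𝓝 a) := by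
  have hX' : ∀ t (h : p t), X t = fun ω => b t * Z (g ⟨t, h⟩) ω m :=
    fun t h => funext fun ω => hX t h ω
  have hcoord : Measurable fun z : EuclideanSpace ℝ (Fin l) => z m := by fun_prop
  refine ae_exists_tendsto_sum_of_summable_variance (fun t => ?_) ?_ (fun t => ?_) (fun t => ?_) ?_
  · by_cases h : p t
    · rw [hX' t h]; exact (hcoord.comp (hmeas _)).const_mul _
    · rw [hX0 t h]; exact measurable_zero
  · refine iIndepFun_of_subtype (p := p) ?_ hX0
    have h1 := (hind.precomp hg).comp (fun t z => b t * z m) fun t => hcoord.const_mul _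
    convert h1 using 1
    funext t
    rw [hX' t.1 t.2]; rfl
  · by_cases h : p t
    · rw [hX' t h]; exact (hL2 _).const_mul _
    · rw [hX0 t h]; exact MemLp.zero
  · by_cases h : p t
    · rw [hX' t h, integral_const_mul, hmean, mul_zero]
    · rw [hX0 t h]; simp
  · refine Summable.of_nonneg_of_le (fun t => variance_nonneg _ _) (fun t => ?_)
      (hΔ.mul_right |V|)
    by_cases h : p t
    · rw [hX' t h, variance_const_mul]
      exact mul_le_mul (sq_le_sq.2 ((hb t).trans (le_abs_self _))) ((hV _).trans (le_abs_self _))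
        (variance_nonneg _ _) (sq_nonneg _)
    · rw [hX0 t h, variance_zero]; positivity

/-! ### The drift operator and its coercivity over windows -/

namespace NetworkLearning

open Classical in
/-- The weight which the protocol gives to the edge from `i` to `j`. -/
noncomputable def edgeWeight {n : ℕ} (G : SimpleGraph (Fin n)) (i j : Fin n) : ℝ :=
  if G.Adj i j then 1 / (max (G.degree i) (G.degree j) : ℝ) else 0

/-- The drift operator of one step of the protocol, acting on one coordinate of the errors. -/
noncomputable def drift {n : ℕ} (G : SimpleGraph (Fin n)) (A : Finset (Fin n)) :
    EuclideanSpace ℝ (Fin n) →L[ℝ] EuclideanSpace ℝ (Fin n) :=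
  LinearMap.toContinuousLinearMap
    { toFun := fun x => WithLp.toLp 2 fun i =>
        1 / 4 * ((if i ∈ A then x i else 0) + ∑ j, edgeWeight G i j * (x i - x j))
      map_add' := fun x y => by
        ext i
        have : ∀ j, edgeWeight G i j * (x i + y i - (x j + y j)) =
          edgeWeight G i j * (x i - x j) + edgeWeight G i j * (y i - y j) := fun j => by ring
        simp only [PiLp.add_apply, this, Finset.sum_add_distrib]
        split_ifs <;> ring
      map_smul' := fun a x => by
        ext i
        have : ∀ j, edgeWeight G i j * (a * x i - a * x j) =
          a * (edgeWeight G i j * (x i - x j)) := fun j => by ring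
        simp only [PiLp.smul_apply, smul_eq_mul, RingHom.id_apply, this, ← Finset.mul_sum]
        split_ifs <;> ring }

section Operator

variable {n : ℕ} {G : SimpleGraph (Fin n)} {A : Finset (Fin n)}

theorem drift_apply (x : EuclideanSpace ℝ (Fin n)) (i : Fin n) :
    drift G A x i =
      1 / 4 * ((if i ∈ A then x i else 0) + ∑ j, edgeWeight G i j * (x i - x j)) := rfl

theorem edgeWeight_comm (i j : Fin n) : edgeWeight G i j = edgeWeight G j i := by
  by_cases h : G.Adj i j
  · simp [edgeWeight, h, h.symm, max_comm]
  · have h' : ¬ G.Adj j i := fun h' => h h'.symm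
    simp [edgeWeight, h, h']

theorem edgeWeight_nonneg (i j : Fin n) : 0 ≤ edgeWeight G i j := by
  unfold edgeWeight; split_ifs <;> positivity

theorem edgeWeight_le_one (i j : Fin n) : edgeWeight G i j ≤ 1 := by
  unfold edgeWeight
  split_ifs
  · rw [← Nat.cast_max, one_div]; exact Nat.cast_inv_le_one _
  · exact zero_le_one

theorem one_le_card_mul_edgeWeight {i j : Fin n} (h : G.Adj i j) : 1 ≤ n * edgeWeight G i j := by
  classical
  have h1 : ∀ k, G.degree k ≤ n := fun k => by
    simpa using (G.degree_lt_card_verts k).le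
  have h2 : 0 < G.degree i := (G.degree_pos_iff_exists_adj i).2 ⟨j, h⟩
  rw [edgeWeight, if_pos h, ← Nat.cast_max, mul_one_div, le_div_iff₀ (by
    exact_mod_cast lt_max_of_lt_left (by convert h2)), one_mul]
  exact_mod_cast max_le (by convert h1 i) (by convert h1 j)

/-- Since the weights are symmetric, exchanging `i` and `j` and averaging turns the Laplacian part
into a Dirichlet form. -/
theorem inner_drift (x : EuclideanSpace ℝ (Fin n)) :
    inner ℝ (drift G A x) x = 1 / 4 * (∑ i, (if i ∈ A then x i ^ 2 else 0) +
      1 / 2 * ∑ i, ∑ j, edgeWeight G i j * (x i - x j) ^ 2) := by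
  have hsw : ∑ i, ∑ j, edgeWeight G i j * (x i - x j) * x i =
      ∑ i, ∑ j, edgeWeight G i j * (x j - x i) * x j := by
    rw [Finset.sum_comm]
    exact Finset.sum_congr rfl fun i _ => Finset.sum_congr rfl fun j _ => by
      rw [edgeWeight_comm]
  have hadd : ∑ i, ∑ j, edgeWeight G i j * (x i - x j) ^ 2 =
      ∑ i, ∑ j, edgeWeight G i j * (x i - x j) * x i +
      ∑ i, ∑ j, edgeWeight G i j * (x j - x i) * x j := by
    simp only [← Finset.sum_add_distrib]
    exact Finset.sum_congr rfl fun i _ => Finset.sum_congr rfl fun j _ => by ring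
  rw [hadd, ← hsw, PiLp.inner_apply]
  have : ∀ i, inner ℝ (drift G A x i) (x i) = 1 / 4 * ((if i ∈ A then x i ^ 2 else 0) +
      ∑ j, edgeWeight G i j * (x i - x j) * x i) := fun i => by
    rw [drift_apply, ← Finset.sum_mul]
    simp only [RCLike.inner_apply, conj_trivial]
    split_ifs <;> ring
  simp only [this, ← Finset.mul_sum, Finset.sum_add_distrib]
  ring

theorem inner_drift_nonneg (x : EuclideanSpace ℝ (Fin n)) : 0 ≤ inner ℝ (drift G A x) x := by
  rw [inner_drift]
  have h1 : 0 ≤ ∑ i, (if i ∈ A then x i ^ 2 else 0) :=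
    Finset.sum_nonneg fun i _ => by split_ifs <;> positivity
  have h2 : 0 ≤ ∑ i, ∑ j, edgeWeight G i j * (x i - x j) ^ 2 :=
    Finset.sum_nonneg fun i _ => Finset.sum_nonneg fun j _ =>
      mul_nonneg (edgeWeight_nonneg _ _) (sq_nonneg _)
  linarith

/-- One ordered pair contributes with factor `1/8` times its weight, and the weight is at least
`1/n`. -/
theorem sq_sub_le_inner_drift {i j : Fin n} (h : G.Adj i j) (x : EuclideanSpace ℝ (Fin n)) :
    (x i - x j) ^ 2 ≤ 8 * n * inner ℝ (drift G A x) x := by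
  rw [inner_drift]
  have h1 : 0 ≤ ∑ i, (if i ∈ A then x i ^ 2 else 0) :=
    Finset.sum_nonneg fun i _ => by split_ifs <;> positivity
  have h0 : ∀ i j, 0 ≤ edgeWeight G i j * (x i - x j) ^ 2 := fun i j =>
    mul_nonneg (edgeWeight_nonneg _ _) (sq_nonneg _)
  have h2 : edgeWeight G i j * (x i - x j) ^ 2 ≤
      ∑ i, ∑ j, edgeWeight G i j * (x i - x j) ^ 2 :=
    (Finset.single_le_sum (fun j _ => h0 i j) (Finset.mem_univ j)).trans
      (Finset.single_le_sum (f := fun i => ∑ j, edgeWeight G i j * (x i - x j) ^ 2)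
        (fun i _ => Finset.sum_nonneg fun j _ => h0 i j) (Finset.mem_univ i))
  have h3 := mul_le_mul_of_nonneg_right (one_le_card_mul_edgeWeight h) (sq_nonneg (x i - x j))
  have h4 := mul_le_mul_of_nonneg_left h2 (Nat.cast_nonneg (α := ℝ) n)
  have h5 := mul_nonneg (Nat.cast_nonneg (α := ℝ) n) h1
  linarith

/-- The factor 4 would do; `8 * n` matches the bound for edges. -/
theorem sq_le_inner_drift {i : Fin n} (h : i ∈ A) (x : EuclideanSpace ℝ (Fin n)) :
    x i ^ 2 ≤ 8 * n * inner ℝ (drift G A x) x := by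
  rw [inner_drift]
  have h0 : ∀ i ∈ Finset.univ, 0 ≤ (if i ∈ A then x i ^ 2 else 0) := fun i _ => by
    split_ifs <;> positivity
  have h1 : x i ^ 2 ≤ ∑ i, (if i ∈ A then x i ^ 2 else 0) := by
    simpa [h] using Finset.single_le_sum h0 (Finset.mem_univ i)
  have h2 : 0 ≤ ∑ i, ∑ j, edgeWeight G i j * (x i - x j) ^ 2 :=
    Finset.sum_nonneg fun i _ => Finset.sum_nonneg fun j _ =>
      mul_nonneg (edgeWeight_nonneg _ _) (sq_nonneg _)
  have hn : (1 : ℝ) ≤ n := by exact_mod_cast i.pos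
  have h3 : (x i) ^ 2 ≤ n * ∑ i, (if i ∈ A then x i ^ 2 else 0) :=
    h1.trans (le_mul_of_one_le_left (Finset.sum_nonneg h0) hn)
  have h4 := mul_nonneg (Nat.cast_nonneg (α := ℝ) n) h2
  nlinarith [Finset.sum_nonneg h0]

end Operator

/-- On `n` nodes there are only finitely many graphs and measuring sets. -/
theorem exists_norm_drift_le (n : ℕ) : ∃ C : ℝ, 0 ≤ C ∧
    ∀ (G : SimpleGraph (Fin n)) (A : Finset (Fin n)) (x : EuclideanSpace ℝ (Fin n)),
      ‖drift G A x‖ ≤ C * ‖x‖ := by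
  obtain ⟨C, hC⟩ := (Set.finite_range
    fun p : SimpleGraph (Fin n) × Finset (Fin n) => ‖drift p.1 p.2‖).bddAbove
  exact ⟨max C 0, le_max_right _ _, fun G A x =>
    (drift G A).le_of_opNorm_le ((hC ⟨(G, A), rfl⟩).trans (le_max_left _ _)) x⟩

/-- A function on the vertices whose increments along edges are at most `δ` changes by at most
`δ` times the length along a walk. -/
theorem abs_sub_le_length_mul {V : Type*} {G : SimpleGraph V} {f : V → ℝ} {δ : ℝ}
    (h : ∀ i j, G.Adj i j → |f i - f j| ≤ δ) {u v : V} (p : G.Walk u v) :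
    |f u - f v| ≤ p.length * δ := by
  induction p with
  | nil => simp
  | cons hadj p ih =>
    rw [SimpleGraph.Walk.length_cons]
    push_cast
    have := abs_sub_le (f _) (f _) (f _) |>.trans (add_le_add (h _ _ hadj) ih)
    linarith

/-- Over a set of times at which the graphs are jointly connected and some node measures, the
drifts are jointly coercive. -/
theorem norm_sq_le_sum_inner_drift {n : ℕ} {G : ℕ → SimpleGraph (Fin n)}
    {S : ℕ → Finset (Fin n)} {I : Finset ℕ} (hconn : (⨆ t ∈ I, G t).Connected)
    (hmeas : ∃ t ∈ I, (S t).Nonempty) (x : EuclideanSpace ℝ (Fin n)) :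
    ‖x‖ ^ 2 ≤ n * ((n + 1) ^ 2 * (8 * n)) * ∑ t ∈ I, inner ℝ (drift (G t) (S t) x) x := by
  classical
  set q := ∑ t ∈ I, inner ℝ (drift (G t) (S t) x) x with hq
  have hle : ∀ t ∈ I, inner ℝ (drift (G t) (S t) x) x ≤ q := fun t ht =>
    Finset.single_le_sum (f := fun t => inner ℝ (drift (G t) (S t) x) x)
      (fun _ _ => inner_drift_nonneg x) ht
  have hq0 : 0 ≤ q := Finset.sum_nonneg fun _ _ => inner_drift_nonneg x
  set δ := Real.sqrt (8 * n * q) with hδ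
  have hle' : ∀ t ∈ I, 8 * n * inner ℝ (drift (G t) (S t) x) x ≤ 8 * n * q := fun t ht =>
    mul_le_mul_of_nonneg_left (hle t ht) (by positivity)
  have hedge : ∀ i j, (⨆ t ∈ I, G t).Adj i j → |x i - x j| ≤ δ := by
    intro i j hij
    simp only [SimpleGraph.iSup_adj, exists_prop] at hij
    obtain ⟨t, ht, hadj⟩ := hij
    exact Real.abs_le_sqrt ((sq_sub_le_inner_drift hadj x).trans (hle' t ht))
  obtain ⟨t, ht, r, hr⟩ := hmeas
  have hanchor : |x r| ≤ δ := Real.abs_le_sqrt ((sq_le_inner_drift hr x).trans (hle' t ht))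
  -- A path to the measuring node `r` has at most `n` edges, each costing `δ`; `|x r|` costs one
  -- more.
  have hall : ∀ i, x i ^ 2 ≤ (n + 1) ^ 2 * (8 * n * q) := by
    intro i
    obtain ⟨p, hp⟩ := (hconn.preconnected i r).exists_isPath
    have hlen : (p.length : ℝ) ≤ n := by
      exact_mod_cast (by simpa using hp.length_lt.le)
    have h1 := abs_sub_le_length_mul (f := fun i => x i) hedge p
    have h2 : (p.length : ℝ) * δ ≤ n * δ := mul_le_mul_of_nonneg_right hlen (Real.sqrt_nonneg _)
    have h3 : |x i| ≤ (n + 1) * δ := by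
      have := abs_add_le (x i - x r) (x r)
      rw [sub_add_cancel] at this
      linarith
    have h4 := pow_le_pow_left₀ (abs_nonneg _) h3 2
    rwa [sq_abs, mul_pow, hδ, Real.sq_sqrt (by positivity)] at h4
  rw [EuclideanSpace.real_norm_sq_eq]
  calc ∑ i, x i ^ 2 ≤ ∑ _i : Fin n, ((n : ℝ) + 1) ^ 2 * (8 * n * q) :=
        Finset.sum_le_sum fun i _ => hall i
    _ = _ := by simp; ring

theorem UniformMeasurementSpeed.exists_mem {n : ℕ} {S : ℕ → Finset (Fin n)} {T : ℕ}
    (h : UniformMeasurementSpeed S T) {a : ℕ} (ha : 1 ≤ a) :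
    ∃ t, a ≤ t ∧ t < a + T ∧ (S t).Nonempty := by
  obtain ⟨τ, hmono, hrange, h0, hgap⟩ := h
  have hne : ∀ k, (S (τ k)).Nonempty := fun k => by
    have : τ k ∈ Set.range τ := ⟨k, rfl⟩
    rwa [hrange] at this
  have hex : ∃ k, a ≤ τ k := ⟨a, hmono.le_apply⟩
  classical
  refine ⟨τ (Nat.find hex), Nat.find_spec hex, ?_, hne _⟩
  rcases hk : Nat.find hex with _ | k
  -- Here the time is `τ 0 = 1 ≤ a`, and the gap bound serves only to give `0 < T`.
  · have := hgap 0
    omega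
  · have h1 := Nat.find_min hex (m := k) (by omega)
    have := hgap k
    omega

theorem exists_window_coercive {n : ℕ} {G : ℕ → SimpleGraph (Fin n)} {B : ℕ}
    (hB : 1 ≤ B) (hG : BConnected G B) {S : ℕ → Finset (Fin n)} {T : ℕ}
    (hS : UniformMeasurementSpeed S T) :
    ∃ K : ℕ, 0 < K ∧ ∃ c : ℝ, 0 < c ∧ ∀ k (x : EuclideanSpace ℝ (Fin n)),
      c * ‖x‖ ^ 2 ≤ ∑ j ∈ Finset.range K,
        inner ℝ (drift (G (k * K + 1 + j)) (S (k * K + 1 + j)) x) x := by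
  have hT : 0 < T := by
    obtain ⟨t, h1, h2, -⟩ := hS.exists_mem le_rfl
    omega
  have hn : (0 : ℝ) < n := by
    obtain ⟨i⟩ := (hG 0).nonempty
    exact_mod_cast i.pos
  have hTB : T ≤ T * B := Nat.le_mul_of_pos_right _ hB
  have hBT : B ≤ T * B := Nat.le_mul_of_pos_left _ hT
  -- A window of length `T * B` aligns with the connectivity blocks, containing the block of index
  -- `k * T`, and is long enough to contain a measurement.
  refine ⟨T * B, by positivity, (n * ((n + 1) ^ 2 * (8 * n)) : ℝ)⁻¹, by positivity,
    fun k x => ?_⟩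
  rw [inv_mul_le_iff₀ (by positivity)]
  have hI : ∑ j ∈ Finset.range (T * B), inner ℝ
      (drift (G (k * (T * B) + 1 + j)) (S (k * (T * B) + 1 + j)) x) x =
      ∑ t ∈ Finset.Ico (k * (T * B) + 1) (k * (T * B) + 1 + T * B),
        inner ℝ (drift (G t) (S t) x) x := by
    rw [Finset.sum_Ico_eq_sum_range, Nat.add_sub_cancel_left]
  rw [hI]
  refine norm_sq_le_sum_inner_drift ?_ ?_ x
  · refine (hG (k * T)).mono (biSup_mono fun t ht => ?_)
    have e1 : (k * T + 1) * B = k * (T * B) + B := by ring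
    have e2 : k * T * B = k * (T * B) := by ring
    rw [e1, e2, Finset.mem_Icc] at ht
    rw [Finset.mem_Ico]
    omega
  · obtain ⟨t, h1, h2, h3⟩ := hS.exists_mem (a := k * (T * B) + 1) (by omega)
    exact ⟨t, Finset.mem_Ico.2 ⟨h1, by omega⟩, h3⟩

/-! ### The error recursion and its noise -/

/-- One coordinate of the total noise entering the update at time `t`. -/
noncomputable def noiseInput {n l : ℕ} {Ω : Type*} (G : ℕ → SimpleGraph (Fin n))
    (S : ℕ → Finset (Fin n)) (Δ : ℕ → ℝ)
    (w : ℕ → Fin n → Fin n → Ω → EuclideanSpace ℝ (Fin l))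
    (wm : ℕ → Fin n → Ω → EuclideanSpace ℝ (Fin l)) (m : Fin l) (ω : Ω) (t : ℕ) :
    EuclideanSpace ℝ (Fin n) :=
  WithLp.toLp 2 fun i => (if i ∈ S t then Δ t / 4 * wm t i ω m else 0) +
    ∑ j, Δ t / 4 * edgeWeight (G t) i j * w t i j ω m

theorem error_succ {n l : ℕ} {Ω : Type*}
    (G : ℕ → SimpleGraph (Fin n)) (S : ℕ → Finset (Fin n)) (Δ : ℕ → ℝ)
    (μ : EuclideanSpace ℝ (Fin l))
    (w : ℕ → Fin n → Fin n → Ω → EuclideanSpace ℝ (Fin l))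
    (wm : ℕ → Fin n → Ω → EuclideanSpace ℝ (Fin l))
    (v₀ : Fin n → EuclideanSpace ℝ (Fin l)) (m : Fin l) (ω : Ω) (t : ℕ) :
    (WithLp.toLp 2 fun i => estimate G S Δ μ w wm v₀ (t + 1) i ω m - μ m :
      EuclideanSpace ℝ (Fin n)) =
    (WithLp.toLp 2 fun i => estimate G S Δ μ w wm v₀ t i ω m - μ m) -
      Δ t • drift (G t) (S t)
        (WithLp.toLp 2 fun i => estimate G S Δ μ w wm v₀ t i ω m - μ m) +
      noiseInput G S Δ w wm m ω t := by
  classical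
  ext i
  set v := fun j => estimate G S Δ μ w wm v₀ t j ω
  have hn : (∑ j ∈ (G t).neighborFinset i,
      (1 / (max ((G t).degree i) ((G t).degree j) : ℝ)) • (v j - v i + w t i j ω)) m =
      ∑ j, edgeWeight (G t) i j * (v j m - v i m + w t i j ω m) := by
    rw [SimpleGraph.neighborFinset_eq_filter, Finset.sum_filter, WithLp.ofLp_sum,
      Finset.sum_apply]
    refine Finset.sum_congr rfl fun j _ => ?_
    unfold edgeWeight
    by_cases h : (G t).Adj i j
    · simp only [h, if_true, PiLp.smul_apply, PiLp.add_apply, PiLp.sub_apply, smul_eq_mul]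
    · simp [h]
  have hs : ∑ j, edgeWeight (G t) i j * (v j m - v i m + w t i j ω m) =
      -∑ j, edgeWeight (G t) i j * (v i m - μ m - (v j m - μ m)) +
      ∑ j, edgeWeight (G t) i j * w t i j ω m := by
    rw [← Finset.sum_neg_distrib, ← Finset.sum_add_distrib]
    exact Finset.sum_congr rfl fun j _ => by ring
  have hw : ∑ j, Δ t / 4 * edgeWeight (G t) i j * w t i j ω m =
      Δ t / 4 * ∑ j, edgeWeight (G t) i j * w t i j ω m := by
    rw [Finset.mul_sum]; exact Finset.sum_congr rfl fun j _ => by ring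
  simp only [PiLp.add_apply, PiLp.sub_apply, PiLp.smul_apply, drift_apply, noiseInput, hw,
    smul_eq_mul]
  rw [estimate]
  simp only
  split_ifs with h
  · simp only [PiLp.add_apply, PiLp.sub_apply, PiLp.smul_apply, smul_eq_mul]
    rw [hn, hs]
    ring
  · simp only [PiLp.add_apply, PiLp.smul_apply, smul_eq_mul]
    rw [hn, hs]
    ring

/-- Each ordered pair and each node gives its own scalar series, in which the time index keeps the
noises distinct; finitely many almost sure limits are then added. -/
theorem ae_exists_tendsto_sum_noiseInput {n l : ℕ} {Ω : Type*} [MeasurableSpace Ω]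
    {P : Measure Ω} [IsProbabilityMeasure P]
    {G : ℕ → SimpleGraph (Fin n)} {S : ℕ → Finset (Fin n)} {σ σ' : ℝ}
    {w : ℕ → Fin n → Fin n → Ω → EuclideanSpace ℝ (Fin l)}
    {wm : ℕ → Fin n → Ω → EuclideanSpace ℝ (Fin l)}
    (hnoise : IsNoise P G S w wm σ σ') {Δ : ℕ → ℝ} (hΔ_nonneg : ∀ t, 0 ≤ Δ t)
    (hΔ_sq : Summable fun t : ℕ => Δ t ^ 2) (m : Fin l) :
    ∀ᵐ ω ∂P, ∃ L, Tendsto (fun N => ∑ t ∈ Finset.range N, noiseInput G S Δ w wm m ω t)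
      atTop (𝓝 L) := by
  have h1 : ∀ᵐ ω ∂P, ∀ i j, ∃ a, Tendsto (fun N => ∑ t ∈ Finset.range N,
      Δ t / 4 * edgeWeight (G t) i j * w t i j ω m) atTop (𝓝 a) := by
    rw [ae_all_iff]; intro i
    rw [ae_all_iff]; intro j
    refine ae_exists_tendsto_weighted_sum hnoise.measurable hnoise.indep m
      (fun a => hnoise.memLp a m) (fun a => hnoise.mean_zero a m)
      (p := fun t => (G t).Adj i j) (g := fun t => ⟨t.1, Sum.inl ⟨(i, j), t.2⟩⟩)
      (fun s t hst => Subtype.ext (congrArg Sigma.fst hst))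
      (fun t => (hnoise.variance_offset t.1 i j t.2 m).le)
      (b := fun t => Δ t / 4 * edgeWeight (G t) i j) (fun t => ?_) hΔ_sq
      (fun t h ω => rfl) (fun t h => ?_)
    · have := hΔ_nonneg t
      rw [abs_of_nonneg (mul_nonneg (by positivity) (edgeWeight_nonneg _ _))]
      exact (mul_le_of_le_one_right (by positivity) (edgeWeight_le_one _ _)).trans (by linarith)
    · funext ω; simp [edgeWeight, h]
  have h2 : ∀ᵐ ω ∂P, ∀ i, ∃ a, Tendsto (fun N => ∑ t ∈ Finset.range N,
      (if i ∈ S t then Δ t / 4 * wm t i ω m else 0)) atTop (𝓝 a) := by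
    rw [ae_all_iff]; intro i
    refine ae_exists_tendsto_weighted_sum hnoise.measurable hnoise.indep m
      (fun a => hnoise.memLp a m) (fun a => hnoise.mean_zero a m)
      (p := fun t => i ∈ S t) (g := fun t => ⟨t.1, Sum.inr ⟨i, t.2⟩⟩)
      (fun s t hst => Subtype.ext (congrArg Sigma.fst hst))
      (fun t => (hnoise.variance_measurement t.1 i t.2 m).le)
      (b := fun t => Δ t / 4) (Δ := Δ) (fun t => ?_) hΔ_sq
      (fun t h ω => if_pos h) (fun t h => funext fun ω => if_neg h)
    have := hΔ_nonneg t
    rw [abs_of_nonneg (by positivity)]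
    linarith
  filter_upwards [h1, h2] with ω h1 h2
  choose a ha using h1
  choose b hb using h2
  refine ⟨WithLp.toLp 2 fun i => b i + ∑ j, a i j, ?_⟩
  have hpi : Tendsto (fun N => fun i => ∑ t ∈ Finset.range N,
      ((if i ∈ S t then Δ t / 4 * wm t i ω m else 0) +
        ∑ j, Δ t / 4 * edgeWeight (G t) i j * w t i j ω m)) atTop
      (𝓝 fun i => b i + ∑ j, a i j) := by
    refine tendsto_pi_nhds.2 fun i => ?_
    simp only [Finset.sum_add_distrib]
    refine (hb i).add ?_
    simp only [Finset.sum_comm (s := Finset.range _)]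
    exact tendsto_finsetSum _ fun j _ => ha i j
  refine (((PiLp.continuous_toLp 2 _).tendsto _).comp hpi).congr fun N => ?_
  ext i
  simp [noiseInput, WithLp.ofLp_sum, Finset.sum_apply]

end NetworkLearning

/-! ### Convergence of the protocol -/

/-- A zero step would make all later steps zero and the sum finite. Positivity is what allows
clearing the denominator in the ratio condition. -/
theorem pos_of_antitone_of_tendsto_sum {Δ : ℕ → ℝ} (hΔ_nonneg : ∀ t, 0 ≤ Δ t)
    (hΔ_anti : Antitone Δ)
    (hΔ_sum : Tendsto (fun N : ℕ => ∑ t ∈ Finset.Icc 1 N, Δ t) atTop atTop) (t : ℕ) :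
    0 < Δ t := by
  by_contra h
  have hz : ∀ r ∉ Finset.range t, Δ r = 0 := fun r hr =>
    le_antisymm ((hΔ_anti (by simpa using hr)).trans (not_lt.1 h)) (hΔ_nonneg r)
  have hsum : Summable Δ := summable_of_ne_finset_zero hz
  obtain ⟨N, hN⟩ := (hΔ_sum.eventually_gt_atTop (∑' r, Δ r)).exists
  exact hN.not_ge (Summable.sum_le_tsum _ (fun r _ => hΔ_nonneg r) hsum)

theorem proposition1 {n l : ℕ} {Ω : Type*} [MeasurableSpace Ω]
    (P : Measure Ω) [IsProbabilityMeasure P]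
    (G : ℕ → SimpleGraph (Fin n)) (B : ℕ) (hB : 1 ≤ B) (hG : NetworkLearning.BConnected G B)
    (S : ℕ → Finset (Fin n)) (T : ℕ) (hS : NetworkLearning.UniformMeasurementSpeed S T)
    (μ : EuclideanSpace ℝ (Fin l)) (σ σ' : ℝ)
    (w : ℕ → Fin n → Fin n → Ω → EuclideanSpace ℝ (Fin l))
    (wm : ℕ → Fin n → Ω → EuclideanSpace ℝ (Fin l))
    (hnoise : NetworkLearning.IsNoise P G S w wm σ σ')
    (Δ : ℕ → ℝ) (hΔ_nonneg : ∀ t, 0 ≤ Δ t) (hΔ_anti : Antitone Δ)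
    (hΔ_sum : Tendsto (fun N : ℕ => ∑ t ∈ Finset.Icc 1 N, Δ t) atTop atTop)
    (hΔ_sq : Summable (fun t : ℕ => Δ (t + 1) ^ 2))
    (hΔ_ratio : ∀ c : ℕ, BddAbove {x : ℝ | ∃ t : ℕ, 1 ≤ t ∧ x = Δ t / Δ (t + c)})
    (v₀ : Fin n → EuclideanSpace ℝ (Fin l)) :
    ∀ᵐ ω ∂P, ∀ i : Fin n,
      Tendsto (fun t : ℕ => NetworkLearning.estimate G S Δ μ w wm v₀ t i ω) atTop (𝓝 μ) := by
  have hsq : Summable fun t : ℕ => Δ t ^ 2 := (summable_nat_add_iff 1).1 hΔ_sq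
  have hlim : Tendsto Δ atTop (𝓝 0) := by
    have := hsq.tendsto_atTop_zero.sqrt
    simpa [Real.sqrt_sq (hΔ_nonneg _)] using this
  obtain ⟨K, hK, c, hc0, hc⟩ := NetworkLearning.exists_window_coercive hB hG hS
  obtain ⟨C, hC0, hC⟩ := NetworkLearning.exists_norm_drift_le n
  obtain ⟨R, hR⟩ := hΔ_ratio K
  have hpos := pos_of_antitone_of_tendsto_sum hΔ_nonneg hΔ_anti hΔ_sum
  -- The maximum with 1 makes the constant visibly positive.
  have hρ : ∀ t, 1 ≤ t → Δ t ≤ max R 1 * Δ (t + K) := fun t ht =>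
    (div_le_iff₀ (hpos _)).1 ((hR ⟨t, ht, rfl⟩).trans (le_max_left _ _))
  have hN := ae_all_iff.2 fun m =>
    NetworkLearning.ae_exists_tendsto_sum_noiseInput hnoise hΔ_nonneg hsq m
  filter_upwards [hN] with ω hω i
  have hcoord : ∀ m, Tendsto
      (fun t => NetworkLearning.estimate G S Δ μ w wm v₀ t i ω m) atTop (𝓝 (μ m)) := by
    intro m
    obtain ⟨L, hL⟩ := hω m
    have hx := tendsto_zero_of_window_coercive_of_convergent_noise
      (Q := fun t => NetworkLearning.drift (G t) (S t))
      (x := fun t => WithLp.toLp 2 fun i =>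
        NetworkLearning.estimate G S Δ μ w wm v₀ t i ω m - μ m) hK hC0 (fun t x => hC _ _ x)
      (fun t x => NetworkLearning.inner_drift_nonneg x) hc0 hc hΔ_nonneg hΔ_anti hlim hΔ_sum
      (lt_of_lt_of_le one_pos (le_max_right R 1)) hρ
      (NetworkLearning.error_succ G S Δ μ w wm v₀ m ω) hL
    have hi := ((EuclideanSpace.proj (𝕜 := ℝ) i).continuous.tendsto
      (0 : EuclideanSpace ℝ (Fin n))).comp hx
    simpa using (hi.add_const (μ m))
  have hpi := ((PiLp.continuous_toLp 2 fun _ : Fin l => ℝ).tendsto _).comp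
    (tendsto_pi_nhds.2 hcoord)
  exact hpi
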